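/- **Setting.** Alice and Bob hold independent private random tapes (arbitrary probability spaces; the parties are computationally unbounded) and exchange $n\ge 1$ messages from a countable alphabet in alternate rounds, Alice sending in rounds $1,3,5,\dots$ and Bob in rounds $2,4,6,\dots$. Each message is a function of the sender's tape and of the messages sent so far. After the last round each party outputs a bit, as a function of her tape and of the transcript. If a party aborts instead of sending her message, the other party outputs a bit (its *defense*) as a function of its own tape and of the transcript up to that point. For $X_0\in[0,1]$, this is a *two-party $n$-round bias-$X_0$ coin-tossing protocol* if in an honest execution the two output bits agree almost surely and the common outcome equals heads with probability $X_0$. A *fail-stop adversary* corrupts one of the two parties and follows the protocol honestly, except that in each round in which she is to send a message she may abort, the decision depending on her view (her tape and the transcript so far, and hence also on the message she is about to send). For a function $f$ on $[0,1]$ let $T(f)$ be the function on $[0,1]$ given by $$T(f)(x)=\frac{2\,y^{(1)}y^{(2)}}{y^{(1)}+y^{(2)}},\qquad y^{(1)}=f(x_S),\quad y^{(2)}=f(x_L),$$ where $x_S,x_L\in[0,1]$ are solutions of $x_S+f(x_S)=x$ and $x_L-f(x_L)=x$ (and $T(f)(x)=0$ if $y^{(1)}=y^{(2)}=0$). Put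 $C'_1(X)=X(1-X)$ and $C'_n=T^{n-1}(C'_1)$ for $n\ge 1$. **Theorem.** The curves $C'_k$, $k\ge1$, are well defined: for all $k\ge 1$ and $x\in[0,1]$, each of the equations $X+C'_k(X)=x$ and $X-C'_k(X)=x$ has exactly one solution $X\in[0,1]$. For every $n\ge1$ and every two-party $n$-round bias-$X_0$ coin-tossing protocol there is a fail-stop adversary, corrupting one of the two parties, such that the probability that the honest party outputs heads in the execution with this adversary differs from $X_0$ by at least $$\frac1{12}\,C'_n(X_0)\;\ge\;\frac1{12}\sqrt{\frac{2}{n+1}}\;X_0(1-X_0).$$ -/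

import Mathlib

open MeasureTheory Set

universe u v

/-- The two parties. Alice is the party who sends the first message. -/
inductive Party
  | alice
  | bob
  deriving DecidableEq

instance : Fintype Party := ⟨{.alice, .bob}, fun p => by cases p <;> simp⟩

/-- The opponent of a party. -/
def Party.other : Party → Party
  | .alice => .bob
  | .bob => .alice

/-- The party who sends the next message when `i` messages have already been sent:
the parties alternate and Alice starts. -/
def sender (i : ℕ) : Party := if Even i then .alice else .bob

/-- A pair of interactive randomized parties exchanging messages from `M`.  Party `p` holds a
private random tape in `Ω p` (all her randomness, for messages and outputs alike) and knows the
list of messages sent so far. There is no computational restriction.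
* `next p r t` is the message which `p` sends after the partial transcript `t`;
* `output p r t` is her output bit (`true` is heads) after a complete transcript `t`;
* `defense p r t` is her output bit if the other party aborts instead of sending the message that
  follows the partial transcript `t`. -/
structure TwoPartyProtocol (Ω : Party → Type u) (M : Type v)
    [∀ p, MeasurableSpace (Ω p)] [MeasurableSpace M] where
  next : ∀ p, Ω p → List M → M
  output : ∀ p, Ω p → List M → Bool
  defense : ∀ p, Ω p → List M → Bool
  measurable_next : ∀ p t, Measurable fun r => next p r t
  measurable_output : ∀ p t, Measurable fun r => output p r t
  measurable_defense : ∀ p t, Measurable fun r => defense p r t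

/-- A fail-stop adversary who corrupts party `p`: she follows the protocol, except that each time
it is her turn she decides from her view (her tape and the transcript so far, hence also the message
that she is about to send) whether to abort. -/
structure FailStopAdversary (Ω : Party → Type u) (M : Type v)
    [∀ p, MeasurableSpace (Ω p)] (p : Party) where
  abort : Ω p → List M → Bool
  measurable_abort : ∀ t, Measurable fun r => abort r t

namespace TwoPartyProtocol

variable {Ω : Party → Type u} {M : Type v} [∀ p, MeasurableSpace (Ω p)] [MeasurableSpace M]

/-- One honest round: the party whose turn it is appends her message to the transcript. -/
def extend (P : TwoPartyProtocol Ω M) (ω : ∀ p, Ω p) (t : List M) : List M :=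
  t ++ [P.next (sender t.length) (ω (sender t.length)) t]

/-- The transcript after `i` honest rounds when the tapes are `ω`. -/
def transcript (P : TwoPartyProtocol Ω M) (ω : ∀ p, Ω p) (i : ℕ) : List M :=
  (P.extend ω)^[i] []

/-- The output of party `p` in the honest execution of `n` rounds. -/
def honestOutput (P : TwoPartyProtocol Ω M) (n : ℕ) (p : Party) (ω : ∀ p, Ω p) : Bool :=
  P.output p (ω p) (P.transcript ω n)

/-- `P`, run for `n` rounds with independent tapes distributed according to `μ`, is a coin-tossing
protocol of bias `x`: the parties agree on the outcome, which is heads with probability `x`. -/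
structure IsCoinTossing (P : TwoPartyProtocol Ω M) (μ : ∀ p, Measure (Ω p)) (n : ℕ) (x : ℝ) :
    Prop where
  agree : ∀ᵐ ω ∂(Measure.pi μ), P.honestOutput n .alice ω = P.honestOutput n .bob ω
  bias : ∀ p, (Measure.pi μ).real {ω | P.honestOutput n p ω = true} = x

/-- The output of the honest party `p.other` against a fail-stop adversary corrupting `p`, when `k`
rounds remain after the partial transcript `t`. -/
def attackedOutputFrom (P : TwoPartyProtocol Ω M) {p : Party} (A : FailStopAdversary Ω M p)
    (ω : ∀ p, Ω p) : ℕ → List M → Bool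
  | 0, t => P.output p.other (ω p.other) t
  | k + 1, t =>
    if sender t.length = p ∧ A.abort (ω p) t = true then P.defense p.other (ω p.other) t
    else P.attackedOutputFrom A ω k (P.extend ω t)

/-- The output of the honest party `p.other` in an `n`-round execution with a fail-stop adversary
who corrupts `p`. -/
def attackedOutput (P : TwoPartyProtocol Ω M) (n : ℕ) {p : Party} (A : FailStopAdversary Ω M p)
    (ω : ∀ p, Ω p) : Bool :=
  P.attackedOutputFrom A ω n []

end TwoPartyProtocol

/-- Harmonic mean (with the value `0` at `a = b = 0`). -/
noncomputable def harmonicMean (a b : ℝ) : ℝ := 2 * a * b / (a + b)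

/-- A solution `X ∈ [0,1]` of `X + f X = x`. -/
noncomputable def xS (f : ℝ → ℝ) (x : ℝ) : ℝ :=
  Classical.epsilon fun X => X ∈ Icc (0 : ℝ) 1 ∧ X + f X = x

/-- A solution `X ∈ [0,1]` of `X - f X = x`. -/
noncomputable def xL (f : ℝ → ℝ) (x : ℝ) : ℝ :=
  Classical.epsilon fun X => X ∈ Icc (0 : ℝ) 1 ∧ X - f X = x

/-- The geometric transform `T` of the curve `Y = f X` over `[0,1]`. -/
noncomputable def curveTransform (f : ℝ → ℝ) (x : ℝ) : ℝ :=
  harmonicMean (f (xS f x)) (f (xL f x))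

/-- The curve `T^(n-1) (X (1 - X))`, for `n ≥ 1`. -/
noncomputable def unfairnessCurve (n : ℕ) : ℝ → ℝ :=
  curveTransform^[n - 1] fun X => X * (1 - X)

/-! ### Harmonic means -/

/-! Four attacks are weighed together: either party, pushing towards heads or towards tails. Let a
partial transcript have mass `w` and conditional probability `y` of heads, with `k ≥ 1` rounds left.
Then the optimal gains of the four attacks, weighted by mass, sum to at least `w * C'_k(y) / 3`
(`IsCoinTossing.le_totalGain`). At the empty transcript this is `C'_n(X₀) / 3`, so one attack gains
at least `C'_n(X₀) / 12`; the greedy adversary realizes its optimal gain (`IsCoinTossing.gain_eq`).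

The bound goes by induction on the rounds left. Given the transcript the two tapes are still
independent, so the opponent's defense is heads with a probability `D` that does not depend on the
next message. If message `m` moves the probability of heads to `y_m`, the total gain there is at
least `max (C'_k(y_m) / 3) |D - y_m|`: play on, or let the sender abort in the right direction. The
`y_m` average to `y`, so any affine function below this maximum can be averaged as well, and
`AdmissibleCurve.exists_affine_minorant` provides one whose value at `y` is at least `T(C'_k)(y) /
3`. In the last round every `y_m` is 0 or 1, since independent outputs that agree almost surely are
determined by the transcript.

Geometrically, `T f x` is the height at `x` of the chord of `f` cut off by the lines of slope -1 and
1 through `(x, 0)`. Concavity and end slopes below one make `X ± f X` strictly increasing, and `T`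
preserves these properties. Comparison with parabolas gives the explicit bound. -/

lemma harmonicMean_nonneg {a b : ℝ} (ha : 0 ≤ a) (hb : 0 ≤ b) : 0 ≤ harmonicMean a b := by
  unfold harmonicMean; positivity

/-- After clearing the denominator the difference is twice the square of `θ * a - (1 - θ) * b`.
Hence the harmonic mean is a minimum of linear forms with nonnegative coefficients, which makes it
monotone and concave. -/
lemma harmonicMean_le {a b : ℝ} (ha : 0 ≤ a) (hb : 0 ≤ b) (θ : ℝ) :
    harmonicMean a b ≤ 2 * (θ ^ 2 * a + (1 - θ) ^ 2 * b) := by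
  unfold harmonicMean
  rcases (add_nonneg ha hb).eq_or_lt with h | h
  · rw [← h, div_zero]; positivity
  · rw [div_le_iff₀ h]
    nlinarith [sq_nonneg (θ * a - (1 - θ) * b)]

lemma exists_harmonicMean_eq {a b : ℝ} (ha : 0 ≤ a) (hb : 0 ≤ b) :
    ∃ θ : ℝ, harmonicMean a b = 2 * (θ ^ 2 * a + (1 - θ) ^ 2 * b) := by
  rcases (add_nonneg ha hb).eq_or_lt with h | h
  · obtain rfl : a = 0 := by linarith
    obtain rfl : b = 0 := by linarith
    exact ⟨0, by simp [harmonicMean]⟩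
  · refine ⟨b / (a + b), ?_⟩
    unfold harmonicMean
    field_simp
    ring

lemma harmonicMean_mono {a b a' b' : ℝ} (ha : 0 ≤ a) (hb : 0 ≤ b) (haa : a ≤ a') (hbb : b ≤ b') :
    harmonicMean a b ≤ harmonicMean a' b' := by
  obtain ⟨θ, h⟩ := exists_harmonicMean_eq (ha.trans haa) (hb.trans hbb)
  rw [h]
  refine (harmonicMean_le ha hb θ).trans ?_
  gcongr

lemma harmonicMean_concave {a b a' b' u v A B : ℝ} (ha : 0 ≤ a) (hb : 0 ≤ b) (ha' : 0 ≤ a')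
    (hb' : 0 ≤ b') (hu : 0 ≤ u) (hv : 0 ≤ v) (hA : u * a + v * a' ≤ A) (hB : u * b + v * b' ≤ B) :
    u * harmonicMean a b + v * harmonicMean a' b' ≤ harmonicMean A B := by
  have hA0 : 0 ≤ A := le_trans (by positivity) hA
  have hB0 : 0 ≤ B := le_trans (by positivity) hB
  obtain ⟨θ, h⟩ := exists_harmonicMean_eq hA0 hB0
  rw [h]
  have h1 := mul_le_mul_of_nonneg_left (harmonicMean_le ha hb θ) hu
  have h2 := mul_le_mul_of_nonneg_left (harmonicMean_le ha' hb' θ) hv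
  have h3 := mul_le_mul_of_nonneg_left hA (sq_nonneg θ)
  have h4 := mul_le_mul_of_nonneg_left hB (sq_nonneg (1 - θ))
  linarith

/-! ### Admissible curves -/

/-- The curves to which the transform is applied: concave, nonnegative, vanishing at both ends and
with slopes less than one there. -/
structure AdmissibleCurve (f : ℝ → ℝ) : Prop where
  concave : ConcaveOn ℝ (Icc 0 1) f
  nonneg : ∀ x ∈ Icc (0 : ℝ) 1, 0 ≤ f x
  zero : f 0 = 0
  one : f 1 = 0
  lt_self : ∀ x, 0 < x → x ≤ 1 → f x < x
  lt_compl : ∀ x, 0 ≤ x → x < 1 → f x < 1 - x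

lemma ConcaveOn.chord_le {f : ℝ → ℝ} (hf : ConcaveOn ℝ (Icc 0 1) f) {a b c : ℝ} (ha : 0 ≤ a)
    (hab : a ≤ b) (hbc : b ≤ c) (hc : c ≤ 1) :
    (c - b) * f a + (b - a) * f c ≤ (c - a) * f b := by
  rcases (hab.trans hbc).eq_or_lt with h | h
  · obtain rfl : a = b := by linarith
    subst h
    simp
  · have hca : 0 < c - a := by linarith
    have := hf.2 (show a ∈ Icc (0 : ℝ) 1 from ⟨ha, by linarith⟩)
      (show c ∈ Icc (0 : ℝ) 1 from ⟨by linarith, hc⟩)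
      (show 0 ≤ (c - b) / (c - a) from div_nonneg (by linarith) hca.le)
      (show 0 ≤ (b - a) / (c - a) from div_nonneg (by linarith) hca.le)
      (by field_simp; ring)
    simp only [smul_eq_mul] at this
    have e : (c - b) / (c - a) * a + (b - a) / (c - a) * c = b := by field_simp; ring
    rw [e] at this
    have h2 := mul_le_mul_of_nonneg_left this hca.le
    have e2 : (c - a) * ((c - b) / (c - a) * f a + (b - a) / (c - a) * f c)
        = (c - b) * f a + (b - a) * f c := by field_simp
    linarith

namespace AdmissibleCurve

variable {f g : ℝ → ℝ}

/-- By concavity `f` lies above its chord from `x` to `1`, where it vanishes; that chord has slope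
greater than -1 because `f x < 1 - x`. -/
lemma add_lt_add_apply (hf : AdmissibleCurve f) {x y : ℝ} (hx : 0 ≤ x) (hxy : x < y) (hy : y ≤ 1) :
    x + f x < y + f y := by
  have h := hf.concave.chord_le hx hxy.le hy le_rfl
  have h1 := hf.lt_compl x hx (hxy.trans_le hy)
  rw [hf.one] at h
  have h3 : (y - x) * f x < (y - x) * (1 - x) := mul_lt_mul_of_pos_left h1 (by linarith)
  nlinarith

lemma sub_lt_sub_apply (hf : AdmissibleCurve f) {x y : ℝ} (hx : 0 ≤ x) (hxy : x < y) (hy : y ≤ 1) :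
    x - f x < y - f y := by
  have h := hf.concave.chord_le le_rfl hx hxy.le hy
  have h1 := hf.lt_self y (hx.trans_lt hxy) hy
  rw [hf.zero] at h
  have h3 : (y - x) * f y < (y - x) * y := mul_lt_mul_of_pos_left h1 (by linarith)
  nlinarith

lemma add_le_add_apply (hf : AdmissibleCurve f) {x y : ℝ} (hx : 0 ≤ x) (hxy : x ≤ y) (hy : y ≤ 1) :
    x + f x ≤ y + f y := by
  rcases hxy.eq_or_lt with rfl | h
  · rfl
  · exact (hf.add_lt_add_apply hx h hy).le

lemma sub_le_sub_apply (hf : AdmissibleCurve f) {x y : ℝ} (hx : 0 ≤ x) (hxy : x ≤ y) (hy : y ≤ 1) :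
    x - f x ≤ y - f y := by
  rcases hxy.eq_or_lt with rfl | h
  · rfl
  · exact (hf.sub_lt_sub_apply hx h hy).le

lemma le_of_add_le (hf : AdmissibleCurve f) {x y : ℝ} (hx : x ≤ 1) (hy : 0 ≤ y)
    (h : x + f x ≤ y + f y) : x ≤ y := by
  by_contra! hlt
  exact absurd (hf.add_lt_add_apply hy hlt hx) (not_lt.mpr h)

lemma le_of_sub_le (hf : AdmissibleCurve f) {x y : ℝ} (hx : x ≤ 1) (hy : 0 ≤ y)
    (h : x - f x ≤ y - f y) : x ≤ y := by
  by_contra! hlt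
  exact absurd (hf.sub_lt_sub_apply hy hlt hx) (not_lt.mpr h)

lemma continuousOn (hf : AdmissibleCurve f) : ContinuousOn f (Icc 0 1) := by
  have : LipschitzOnWith 1 f (Icc 0 1) := by
    refine LipschitzOnWith.of_le_add fun x hx y hy => ?_
    rw [Real.dist_eq]
    rcases le_total x y with h | h
    · have := hf.add_le_add_apply hx.1 h hy.2
      rw [abs_of_nonpos (by linarith)]; linarith
    · have := hf.sub_le_sub_apply hy.1 h hx.2
      rw [abs_of_nonneg (by linarith)]; linarith
  exact this.continuousOn

/-- Used with `c = ±1` for the transform and with `c = ±1/3` for the affine minorant. -/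
lemma exists_add_mul (hf : AdmissibleCurve f) (c : ℝ) {x : ℝ} (hx : x ∈ Icc (0 : ℝ) 1) :
    ∃ y ∈ Icc (0 : ℝ) 1, y + c * f y = x := by
  have hc : ContinuousOn (fun y => y + c * f y) (Icc 0 1) :=
    continuousOn_id.add (continuousOn_const.mul hf.continuousOn)
  have := intermediate_value_Icc zero_le_one hc
  simp only [hf.zero, hf.one, mul_zero, add_zero] at this
  obtain ⟨y, hy, h⟩ := this hx
  exact ⟨y, hy, h⟩

lemma exists_add (hf : AdmissibleCurve f) {x : ℝ} (hx : x ∈ Icc (0 : ℝ) 1) :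
    ∃ y, y ∈ Icc (0 : ℝ) 1 ∧ y + f y = x := by
  obtain ⟨y, hy, h⟩ := hf.exists_add_mul 1 hx
  exact ⟨y, hy, by linarith⟩

lemma exists_sub (hf : AdmissibleCurve f) {x : ℝ} (hx : x ∈ Icc (0 : ℝ) 1) :
    ∃ y, y ∈ Icc (0 : ℝ) 1 ∧ y - f y = x := by
  obtain ⟨y, hy, h⟩ := hf.exists_add_mul (-1) hx
  exact ⟨y, hy, by linarith⟩

lemma existsUnique_add (hf : AdmissibleCurve f) {x : ℝ} (hx : x ∈ Icc (0 : ℝ) 1) :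
    ∃! y, y ∈ Icc (0 : ℝ) 1 ∧ y + f y = x := by
  obtain ⟨y, hy, h⟩ := hf.exists_add hx
  refine ⟨y, ⟨hy, h⟩, fun z ⟨hz, h'⟩ => le_antisymm ?_ ?_⟩
  · exact hf.le_of_add_le hz.2 hy.1 (h'.trans h.symm).le
  · exact hf.le_of_add_le hy.2 hz.1 (h.trans h'.symm).le

lemma existsUnique_sub (hf : AdmissibleCurve f) {x : ℝ} (hx : x ∈ Icc (0 : ℝ) 1) :
    ∃! y, y ∈ Icc (0 : ℝ) 1 ∧ y - f y = x := by
  obtain ⟨y, hy, h⟩ := hf.exists_sub hx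
  refine ⟨y, ⟨hy, h⟩, fun z ⟨hz, h'⟩ => le_antisymm ?_ ?_⟩
  · exact hf.le_of_sub_le hz.2 hy.1 (h'.trans h.symm).le
  · exact hf.le_of_sub_le hy.2 hz.1 (h.trans h'.symm).le

lemma xS_spec (hf : AdmissibleCurve f) {x : ℝ} (hx : x ∈ Icc (0 : ℝ) 1) :
    xS f x ∈ Icc (0 : ℝ) 1 ∧ xS f x + f (xS f x) = x :=
  Classical.epsilon_spec (hf.exists_add hx)

lemma xL_spec (hf : AdmissibleCurve f) {x : ℝ} (hx : x ∈ Icc (0 : ℝ) 1) :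
    xL f x ∈ Icc (0 : ℝ) 1 ∧ xL f x - f (xL f x) = x :=
  Classical.epsilon_spec (hf.exists_sub hx)

lemma curveTransform_nonneg (hf : AdmissibleCurve f) {x : ℝ} (hx : x ∈ Icc (0 : ℝ) 1) :
    0 ≤ curveTransform f x :=
  harmonicMean_nonneg (hf.nonneg _ (hf.xS_spec hx).1) (hf.nonneg _ (hf.xL_spec hx).1)

/-- The transform is the value at `x` of the chord of `f` over `[xS, xL]`. -/
lemma exists_slope_curveTransform (hf : AdmissibleCurve f) {x : ℝ} (hx : x ∈ Icc (0 : ℝ) 1) :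
    ∃ s : ℝ, ∀ y ∈ Icc (xS f x) (xL f x), curveTransform f x + s * (y - x) ≤ f y := by
  obtain ⟨hS, hS'⟩ := hf.xS_spec hx
  obtain ⟨hL, hL'⟩ := hf.xL_spec hx
  have h1 := hf.nonneg _ hS
  have h2 := hf.nonneg _ hL
  unfold curveTransform harmonicMean
  set a := xS f x
  set b := xL f x
  refine ⟨(f b - f a) / (f a + f b), fun y hy => ?_⟩
  rcases (add_nonneg h1 h2).eq_or_lt with h | h
  · rw [← h]
    simpa using hf.nonneg y ⟨hS.1.trans hy.1, hy.2.trans hL.2⟩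
  · have := hf.concave.chord_le hS.1 hy.1 hy.2 hL.2
    have e : b - a = f a + f b := by linarith
    have ha : a = x - f a := by linarith
    have hb : b = x + f b := by linarith
    have e3 : (b - y) * f a + (y - a) * f b = 2 * f a * f b + (f b - f a) * (y - x) := by
      linear_combination f a * hb - f b * ha
    rw [e, e3] at this
    rw [div_mul_eq_mul_div, ← add_div, div_le_iff₀ h]
    linarith

lemma curveTransform_le (hf : AdmissibleCurve f) {x : ℝ} (hx : x ∈ Icc (0 : ℝ) 1) :
    curveTransform f x ≤ f x := by
  obtain ⟨s, hs⟩ := hf.exists_slope_curveTransform hx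
  obtain ⟨hS, hS'⟩ := hf.xS_spec hx
  obtain ⟨hL, hL'⟩ := hf.xL_spec hx
  have := hs x ⟨by linarith [hf.nonneg _ hS], by linarith [hf.nonneg _ hL]⟩
  simpa using this

lemma transform (hf : AdmissibleCurve f) : AdmissibleCurve (curveTransform f) where
  nonneg x hx := hf.curveTransform_nonneg hx
  zero := le_antisymm ((hf.curveTransform_le (by simp)).trans hf.zero.le)
    (hf.curveTransform_nonneg (by simp))
  one := le_antisymm ((hf.curveTransform_le (by simp)).trans hf.one.le)
    (hf.curveTransform_nonneg (by simp))
  lt_self x h0 h1 := (hf.curveTransform_le ⟨h0.le, h1⟩).trans_lt (hf.lt_self x h0 h1)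
  lt_compl x h0 h1 := (hf.curveTransform_le ⟨h0, h1.le⟩).trans_lt (hf.lt_compl x h0 h1)
  concave := by
    refine ⟨convex_Icc 0 1, fun x hx y hy u v hu hv huv => ?_⟩
    have hz := convex_Icc (0 : ℝ) 1 hx hy hu hv huv
    simp only [smul_eq_mul] at hz ⊢
    obtain ⟨hSx, ex⟩ := hf.xS_spec hx
    obtain ⟨hSy, ey⟩ := hf.xS_spec hy
    obtain ⟨hSz, ez⟩ := hf.xS_spec hz
    obtain ⟨hLx, ex'⟩ := hf.xL_spec hx
    obtain ⟨hLy, ey'⟩ := hf.xL_spec hy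
    obtain ⟨hLz, ez'⟩ := hf.xL_spec hz
    have hS := hf.concave.2 hSx hSy hu hv huv
    have hL := hf.concave.2 hLx hLy hu hv huv
    have mS := convex_Icc (0 : ℝ) 1 hSx hSy hu hv huv
    have mL := convex_Icc (0 : ℝ) 1 hLx hLy hu hv huv
    simp only [smul_eq_mul] at hS hL mS mL
    -- As inverses of the increasing functions `X + f X` (concave) and `X - f X` (convex), `xS` is
    -- convex and `xL` is concave. So both heights, `x - xS` and `xL - x`, are concave in `x`.
    have kS := hf.le_of_add_le hSz.2 mS.1
      (by linear_combination ez + hS - u * ex - v * ey)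
    have kL := hf.le_of_sub_le mL.2 hLz.1
      (by linear_combination - ez' + hL + u * ex' + v * ey')
    refine harmonicMean_concave (hf.nonneg _ hSx) (hf.nonneg _ hLx) (hf.nonneg _ hSy)
      (hf.nonneg _ hLy) hu hv ?_ ?_
    · linear_combination kS + u * ex + v * ey - ez
    · linear_combination kL - u * ex' - v * ey' + ez'

/-- A higher curve moves `xS` to the left and `xL` to the right, so the heights `x - xS` and `xL -
x` both grow. -/
lemma curveTransform_mono (hf : AdmissibleCurve f) (hg : AdmissibleCurve g)
    (hfg : ∀ x ∈ Icc (0 : ℝ) 1, f x ≤ g x) {x : ℝ} (hx : x ∈ Icc (0 : ℝ) 1) :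
    curveTransform f x ≤ curveTransform g x := by
  obtain ⟨hS, e⟩ := hf.xS_spec hx
  obtain ⟨hS', e'⟩ := hg.xS_spec hx
  obtain ⟨hL, d⟩ := hf.xL_spec hx
  obtain ⟨hL', d'⟩ := hg.xL_spec hx
  have kS := hg.le_of_add_le hS'.2 hS.1 (by linarith [hfg _ hS])
  have kL := hg.le_of_sub_le hL.2 hL'.1 (by linarith [hfg _ hL])
  exact harmonicMean_mono (hf.nonneg _ hS) (hf.nonneg _ hL) (by linarith) (by linarith)

/-- Whatever the defense `D`, there is an affine minorant of `max (f / 3) |D - ·|` which is at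
least a third of the transform of `f` at `x`. -/
lemma exists_affine_minorant (hf : AdmissibleCurve f) {D x : ℝ} (hD : D ∈ Icc (0 : ℝ) 1)
    (hx : x ∈ Icc (0 : ℝ) 1) :
    ∃ α β : ℝ, 1 / 3 * curveTransform f x ≤ α + β * x ∧
      ∀ y ∈ Icc (0 : ℝ) 1, α + β * y ≤ max (1 / 3 * f y) |D - y| := by
  -- `L ≤ D ≤ R` are the points where `f / 3` meets the two branches of `|D - ·|`. The minorant is a
  -- branch when `x` lies outside `[L, R]`, and the chord of `f / 3` over `[L, R]` otherwise (zero
  -- if `L = R`).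
  obtain ⟨L, hL, eL⟩ := hf.exists_add_mul (1 / 3) hD
  obtain ⟨R, hR, eR⟩ := hf.exists_add_mul (-(1 / 3)) hD
  have fL := hf.nonneg L hL
  have fR := hf.nonneg R hR
  have hT := hf.curveTransform_le hx
  rcases lt_or_ge x L with hxL | hLx
  · refine ⟨D, -1, ?_, fun y _ => ?_⟩
    · have := hf.add_le_add_apply hx.1 hxL.le hL.2
      linarith
    · exact le_max_of_le_right (le_trans (by linarith) (le_abs_self (D - y)))
  rcases lt_or_ge R x with hRx | hxR
  · refine ⟨-D, 1, ?_, fun y _ => ?_⟩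
    · have := hf.sub_le_sub_apply hR.1 hRx.le hx.2
      linarith
    · exact le_max_of_le_right (le_trans (by linarith) (neg_le_abs (D - y)))
  rcases (hLx.trans hxR).eq_or_lt with h | hLR
  · refine ⟨0, 0, ?_, fun y _ => ?_⟩
    · subst h
      obtain rfl : x = L := by linarith
      linarith
    · exact le_max_of_le_right (le_trans (by linarith) (abs_nonneg (D - y)))
  have lip1 := hf.add_le_add_apply hL.1 hLR.le hR.2
  have lip2 := hf.sub_le_sub_apply hL.1 hLR.le hR.2
  have hd : 0 < R - L := by linarith
  obtain ⟨s, hs⟩ : ∃ s, s = (f R - f L) / (3 * (R - L)) := ⟨_, rfl⟩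
  have hs' : s * (R - L) = 1 / 3 * (f R - f L) := by rw [hs]; field_simp
  have s1 : s ≤ 1 := by rw [hs, div_le_one (by linarith)]; linarith
  have s2 : -1 ≤ s := by rw [hs, le_div_iff₀ (by linarith)]; linarith
  refine ⟨1 / 3 * f L - s * L, s, ?_, fun y hy => ?_⟩
  · obtain ⟨hS, e⟩ := hf.xS_spec hx
    obtain ⟨hU, d⟩ := hf.xL_spec hx
    obtain ⟨q, hq⟩ := hf.exists_slope_curveTransform hx
    -- This is what the factor `1 / 3` is for: `R - L = (f L + f R) / 3` and `|f R - f L| ≤ R - L`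
    -- give `R - L ≤ min (f L) (f R)`. Hence `L` and `R` lie in `[xS, xL]`, and the chord over `[L,
    -- R]` is above the one over `[xS, xL]`.
    have kS := hf.le_of_add_le hS.2 hL.1 (by linarith)
    have kU := hf.le_of_sub_le hR.2 hU.1 (by linarith)
    have q1 := mul_le_mul_of_nonneg_left (hq L ⟨kS, hLR.le.trans kU⟩) (sub_nonneg.2 hxR)
    have q2 := mul_le_mul_of_nonneg_left (hq R ⟨kS.trans hLR.le, kU⟩) (sub_nonneg.2 hLx)
    refine le_of_mul_le_mul_left ?_ hd
    linear_combination 1 / 3 * q1 + 1 / 3 * q2 - (x - L) * hs'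
  -- Outside `[L, R]` the line stays below the branches of `|D - ·|`, which it meets at `L` and `R`,
  -- because its slope is in `[-1, 1]`.
  · rcases lt_or_ge y L with hyL | hLy
    · refine le_max_of_le_right (le_trans ?_ (le_abs_self (D - y)))
      nlinarith
    rcases lt_or_ge R y with hRy | hyR
    · refine le_max_of_le_right (le_trans ?_ (neg_le_abs (D - y)))
      nlinarith
    refine le_max_of_le_left ?_
    have := hf.concave.chord_le hL.1 hLy hyR hR.2
    refine le_of_mul_le_mul_left ?_ hd
    linear_combination 1 / 3 * this + (y - L) * hs'

end AdmissibleCurve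

/-! ### Parabolas as lower bounds for the curves -/

lemma admissibleCurve_parabola {a : ℝ} (ha : 0 < a) (ha1 : a ≤ 1) :
    AdmissibleCurve fun x => a * (x * (1 - x)) where
  concave := by
    refine ⟨convex_Icc 0 1, fun x _ y _ u v hu hv huv => ?_⟩
    obtain rfl : v = 1 - u := by linarith
    simp only [smul_eq_mul]
    have : 0 ≤ a * (u * (1 - u) * (x - y) ^ 2) := by positivity
    linear_combination this
  nonneg x hx := mul_nonneg ha.le (mul_nonneg hx.1 (by linarith [hx.2]))
  zero := by simp
  one := by simp
  lt_self x h0 h1 := by nlinarith [mul_pos ha (mul_pos h0 h0)]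
  lt_compl x h0 h1 := by
    nlinarith [mul_pos ha (mul_pos (sub_pos.2 h1) (sub_pos.2 h1)), mul_nonneg h0 (sub_pos.2 h1).le]

/-- For interior `x`, the equations of the two heights `y`, `z` combine to `2yz / (y + z) = 2a x(1 -
x) / (2 + a(y + z))`, so it suffices that `2 + a(y + z) ≤ 2a / b`. -/
lemma le_curveTransform_parabola {a b : ℝ} (ha : 0 < a) (ha1 : a ≤ 1) (hb : 0 < b)
    (hab : 1 / b ^ 2 = 1 / a ^ 2 + 1 / 2) {x : ℝ} (hx : x ∈ Icc (0 : ℝ) 1) :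
    b * (x * (1 - x)) ≤ curveTransform (fun x => a * (x * (1 - x))) x := by
  have hf := admissibleCurve_parabola ha ha1
  rcases hx.1.eq_or_lt with rfl | h0
  · simpa using hf.curveTransform_nonneg hx
  rcases hx.2.eq_or_lt with rfl | h1
  · simpa using hf.curveTransform_nonneg hx
  obtain ⟨hS, e⟩ := hf.xS_spec hx
  obtain ⟨hL, d⟩ := hf.xL_spec hx
  have n1 := hf.nonneg _ hS
  have n2 := hf.nonneg _ hL
  unfold curveTransform harmonicMean
  set p := xS (fun x => a * (x * (1 - x))) x
  set q := xL (fun x => a * (x * (1 - x))) x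
  clear_value p q
  simp only at e d n1 n2 ⊢
  obtain ⟨y, hy⟩ : ∃ y, y = a * (p * (1 - p)) := ⟨_, rfl⟩
  obtain ⟨z, hz⟩ : ∃ z, z = a * (q * (1 - q)) := ⟨_, rfl⟩
  rw [← hy] at e n1 ⊢
  rw [← hz] at d n2 ⊢
  obtain rfl : p = x - y := by linarith
  obtain rfl : q = x + z := by linarith
  have hpos : 0 < x * (1 - x) := mul_pos h0 (by linarith)
  have ypos : 0 < y := by
    refine lt_of_le_of_ne n1 fun h => ?_
    rw [← h] at hy
    nlinarith [mul_pos ha hpos]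
  have zpos : 0 < z := by
    refine lt_of_le_of_ne n2 fun h => ?_
    rw [← h] at hz
    nlinarith [mul_pos ha hpos]
  obtain ⟨c, hc⟩ : ∃ c, c = a / b := ⟨_, rfl⟩
  have cpos : 0 < c := by rw [hc]; positivity
  have hc2 : c ^ 2 = 1 + a ^ 2 / 2 := by
    rw [hc, div_pow]
    field_simp at hab ⊢
    linarith
  -- the sum of the two heights, from the quadratic equations which they satisfy
  have key : 2 + a * (y + z) ≤ 2 * c := by
    -- `S` and `U` are the square roots of the discriminants of the two quadratics. The sum `S ^ 2 +
    -- U ^ 2` is free of `x`, which bounds their average `W` uniformly.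
    obtain ⟨S, hS⟩ : ∃ S, S = 2 * a * y + 1 - a * (2 * x - 1) := ⟨_, rfl⟩
    obtain ⟨U, hU⟩ : ∃ U, U = 2 * a * z + 1 + a * (2 * x - 1) := ⟨_, rfl⟩
    have S2 : S ^ 2 = 1 + a ^ 2 - 2 * a * (2 * x - 1) := by
      rw [hS]; linear_combination 4 * a * hy
    have U2 : U ^ 2 = 1 + a ^ 2 + 2 * a * (2 * x - 1) := by
      rw [hU]; linear_combination 4 * a * hz
    obtain ⟨W, hW⟩ : ∃ W, W = (S + U) / 2 := ⟨_, rfl⟩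
    have W2 : W ^ 2 ≤ 1 + a ^ 2 := by rw [hW]; nlinarith [sq_nonneg (S - U)]
    have : 1 + W ≤ 2 * c := by
      refine abs_le_of_sq_le_sq' ?_ (by positivity) |>.2
      nlinarith [sq_nonneg (1 - W)]
    have : W = a * (y + z) + 1 := by rw [hW, hS, hU]; ring
    linarith
  rw [le_div_iff₀ (by linarith)]
  have e1 : 2 * (y * z) + a * (y * z) * (y + z) = a * (x * (1 - x)) * (y + z) := by
    linear_combination z * hy + y * hz
  have hyz : 0 < y * z := mul_pos ypos zpos
  have k := mul_le_mul_of_nonneg_left key hyz.le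
  have k2 : a * (x * (1 - x)) * (y + z) ≤ 2 * c * (y * z) := by nlinarith
  have hbc : b * c = a := by rw [hc]; field_simp
  have k3 := mul_le_mul_of_nonneg_left k2 hb.le
  refine le_of_mul_le_mul_left ?_ ha
  linear_combination k3 + 2 * (y * z) * hbc

lemma unfairnessCurve_one : unfairnessCurve 1 = fun X => X * (1 - X) := rfl

lemma unfairnessCurve_succ_succ (k : ℕ) :
    unfairnessCurve (k + 2) = curveTransform (unfairnessCurve (k + 1)) := by
  simp [unfairnessCurve, Function.iterate_succ_apply']

lemma admissibleCurve_unfairnessCurve (k : ℕ) : AdmissibleCurve (unfairnessCurve (k + 1)) := by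
  induction k with
  | zero => simpa [unfairnessCurve_one] using admissibleCurve_parabola one_pos le_rfl
  | succ k ih => rw [unfairnessCurve_succ_succ]; exact ih.transform

/-- The inverse square of the coefficient starts at 1 and grows by `1 / 2` with each transform, so
it is `(n + 1) / 2` for the `n`-th curve. -/
lemma le_unfairnessCurve (k : ℕ) {x : ℝ} (hx : x ∈ Icc (0 : ℝ) 1) :
    Real.sqrt (2 / ((k + 1 : ℕ) + 1 : ℝ)) * (x * (1 - x)) ≤ unfairnessCurve (k + 1) x := by
  induction k generalizing x with
  | zero => norm_num [unfairnessCurve_one]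
  | succ k ih =>
    rw [unfairnessCurve_succ_succ]
    have h1 : Real.sqrt (2 / ((k + 1 : ℕ) + 1 : ℝ)) ≤ 1 := by
      rw [Real.sqrt_le_one, div_le_one (by positivity)]
      push_cast; linarith [(Nat.cast_nonneg k : (0 : ℝ) ≤ k)]
    have h0 : 0 < Real.sqrt (2 / ((k + 1 : ℕ) + 1 : ℝ)) := by positivity
    refine (le_curveTransform_parabola h0 h1 (by positivity) ?_ hx).trans
      ((admissibleCurve_parabola h0 h1).curveTransform_mono
        (admissibleCurve_unfairnessCurve k) (fun y hy => ih hy) hx)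
    rw [Real.sq_sqrt (by positivity), Real.sq_sqrt (by positivity)]
    push_cast
    field_simp

/-! ### Transcripts and rectangles -/

lemma Party.other_ne (p : Party) : p.other ≠ p := by cases p <;> simp [Party.other]

lemma Party.prod_eq (p : Party) (f : Party → ℝ) : ∏ q, f q = f p * f p.other := by
  have : (Finset.univ : Finset Party) = {.alice, .bob} := rfl
  cases p <;> simp [this, Party.other, mul_comm]

lemma measureReal_party_pi {Ω : Party → Type u} [∀ p, MeasurableSpace (Ω p)]
    (μ : ∀ p, Measure (Ω p)) [∀ p, IsProbabilityMeasure (μ p)] (p : Party) (Q : ∀ q, Set (Ω q)) :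
    (Measure.pi μ).real (univ.pi Q) = (μ p).real (Q p) * (μ p.other).real (Q p.other) := by
  rw [← Party.prod_eq p fun q => (μ q).real (Q q), measureReal_def, Measure.pi_pi,
    ENNReal.toReal_prod]
  rfl

namespace TwoPartyProtocol

variable {Ω : Party → Type u} {M : Type v} [∀ p, MeasurableSpace (Ω p)] [MeasurableSpace M]

/-- The tapes of party `p` which are consistent with the partial transcript `t`. -/
def consistent (P : TwoPartyProtocol Ω M) (t : List M) (p : Party) : Set (Ω p) :=
  {r | ∀ s m, s ++ [m] <+: t → sender s.length = p → P.next p r s = m}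

/-- The event that the transcript of the honest execution starts with `t`. -/
def cylinder (P : TwoPartyProtocol Ω M) (t : List M) : Set (∀ p, Ω p) :=
  univ.pi (P.consistent t)

lemma consistent_nil (P : TwoPartyProtocol Ω M) (p : Party) : P.consistent [] p = univ := by
  ext r; simp [consistent]

lemma cylinder_nil (P : TwoPartyProtocol Ω M) : P.cylinder [] = univ := by
  simp only [cylinder, eq_univ_iff_forall, mem_univ_pi, consistent_nil, mem_univ, implies_true]

lemma consistent_concat (P : TwoPartyProtocol Ω M) (t : List M) (m : M) (p : Party) :
    P.consistent (t ++ [m]) p =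
      P.consistent t p ∩ {r | sender t.length = p → P.next p r t = m} := by
  ext r
  simp only [consistent, mem_ofPred_eq, mem_inter_iff]
  constructor
  · exact fun h => ⟨fun s a hs => h s a (hs.trans (List.prefix_append _ _)),
      fun hp => h t m List.prefix_rfl hp⟩
  · rintro ⟨h1, h2⟩ s a hs hp
    rcases List.prefix_concat_iff.1 hs with h | h
    · obtain ⟨rfl, h⟩ := List.append_inj' h rfl
      obtain rfl : a = m := by simpa using h
      exact h2 hp
    · exact h1 s a h hp

lemma consistent_concat_of_ne (P : TwoPartyProtocol Ω M) (t : List M) (m : M) {p : Party}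
    (hp : sender t.length ≠ p) : P.consistent (t ++ [m]) p = P.consistent t p := by
  rw [consistent_concat]
  ext r
  simp [hp]

lemma mem_cylinder_concat (P : TwoPartyProtocol Ω M) {t : List M} {m : M} {ω : ∀ p, Ω p} :
    ω ∈ P.cylinder (t ++ [m]) ↔
      ω ∈ P.cylinder t ∧ P.next (sender t.length) (ω (sender t.length)) t = m := by
  simp only [cylinder, consistent_concat, mem_univ_pi, mem_inter_iff, mem_ofPred_eq, forall_and]
  refine and_congr_right fun _ => ⟨fun h => h _ rfl, ?_⟩
  rintro h p rfl
  exact h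

lemma extend_of_mem_cylinder (P : TwoPartyProtocol Ω M) {t : List M} {m : M} {ω : ∀ p, Ω p}
    (h : ω ∈ P.cylinder (t ++ [m])) : P.extend ω t = t ++ [m] := by
  rw [extend, (P.mem_cylinder_concat.1 h).2]

lemma transcript_of_mem_cylinder (P : TwoPartyProtocol Ω M) {t : List M} {ω : ∀ p, Ω p}
    (h : ω ∈ P.cylinder t) : P.transcript ω t.length = t := by
  induction t using List.reverseRecOn with
  | nil => rfl
  | append_singleton t m ih =>
    rw [List.length_append, List.length_singleton, transcript, Function.iterate_succ_apply']
    change P.extend ω (P.transcript ω t.length) = _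
    rw [ih (P.mem_cylinder_concat.1 h).1, P.extend_of_mem_cylinder h]

lemma honestOutput_of_mem_cylinder (P : TwoPartyProtocol Ω M) {t : List M} {ω : ∀ p, Ω p}
    (h : ω ∈ P.cylinder t) (p : Party) :
    P.honestOutput t.length p ω = P.output p (ω p) t := by
  rw [honestOutput, P.transcript_of_mem_cylinder h]

/-! ### Masses attached to a partial transcript -/

variable (P : TwoPartyProtocol Ω M) (μ : ∀ p, Measure (Ω p)) (n : ℕ)

/-- The probability that the transcript starts with `t`. -/
noncomputable def mass (t : List M) : ℝ := (Measure.pi μ).real (P.cylinder t)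

/-- The probability that the transcript starts with `t` and the honest outcome is heads. -/
noncomputable def headsMass (t : List M) : ℝ :=
  (Measure.pi μ).real (P.cylinder t ∩ {ω | P.honestOutput n .alice ω = true})

/-- The probability that the transcript starts with `t ++ [m]` and the defense of the opponent of
`p` after `t` is heads. -/
noncomputable def defenseMass (p : Party) (t : List M) (m : M) : ℝ :=
  (Measure.pi μ).real (P.cylinder (t ++ [m]) ∩ {ω | P.defense p.other (ω p.other) t = true})

/-- The gain, on the event that the transcript starts with `t`, of the best fail-stop attack of
party `p` in the last `k` rounds, towards heads if `σ = 1` and towards tails if `σ = -1`. -/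
noncomputable def gain (p : Party) (σ : ℝ) : ℕ → List M → ℝ
  | 0, _ => 0
  | k + 1, t =>
    if sender t.length = p then
      ∑' m, max (gain p σ k (t ++ [m]))
        (σ * (P.defenseMass μ p t m - P.headsMass μ n (t ++ [m])))
    else ∑' m, gain p σ k (t ++ [m])

lemma mass_nonneg (t : List M) : 0 ≤ P.mass μ t := measureReal_nonneg

lemma headsMass_nonneg (t : List M) : 0 ≤ P.headsMass μ n t := measureReal_nonneg

lemma defenseMass_nonneg (p : Party) (t : List M) (m : M) : 0 ≤ P.defenseMass μ p t m :=
  measureReal_nonneg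

/-- The sum of the gains of the four best attacks. -/
noncomputable def totalGain (k : ℕ) (t : List M) : ℝ :=
  ∑ p : Party, (P.gain μ n p 1 k t + P.gain μ n p (-1) k t)

lemma totalGain_eq (p : Party) (k : ℕ) (t : List M) :
    P.totalGain μ n k t = (P.gain μ n p 1 k t + P.gain μ n p (-1) k t) +
      (P.gain μ n p.other 1 k t + P.gain μ n p.other (-1) k t) := by
  have : (Finset.univ : Finset Party) = {.alice, .bob} := rfl
  cases p <;> simp [totalGain, this, Party.other, add_comm]

variable {P μ n} in
lemma IsCoinTossing.headsMass_eq {x : ℝ} (hP : P.IsCoinTossing μ n x) (p : Party) (t : List M) :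
    P.headsMass μ n t =
      (Measure.pi μ).real (P.cylinder t ∩ {ω | P.honestOutput n p ω = true}) := by
  cases p
  · rfl
  · refine measureReal_congr ?_
    filter_upwards [hP.agree] with ω h
    apply propext
    change _ ∧ _ ↔ _ ∧ _
    simp [h]

variable [∀ p, IsProbabilityMeasure (μ p)]

lemma headsMass_le (t : List M) : P.headsMass μ n t ≤ P.mass μ t :=
  measureReal_mono inter_subset_left

lemma defenseMass_le (p : Party) (t : List M) (m : M) :
    P.defenseMass μ p t m ≤ P.mass μ (t ++ [m]) :=
  measureReal_mono inter_subset_left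

/-- The defense is independent of the message of the sender. -/
lemma exists_defenseMass_eq {p : Party} {t : List M} (hp : sender t.length = p) :
    ∃ D ∈ Icc (0 : ℝ) 1, ∀ m, P.defenseMass μ p t m = D * P.mass μ (t ++ [m]) := by
  have hne : sender t.length ≠ p.other := hp ▸ (Party.other_ne _).symm
  set c := (μ p.other).real (P.consistent t p.other)
  set d := (μ p.other).real (P.consistent t p.other ∩ {r | P.defense p.other r t = true})
  have hdc : d ≤ c := measureReal_mono inter_subset_left
  have hd : 0 ≤ d := measureReal_nonneg
  have hc : 0 ≤ c := measureReal_nonneg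
  -- The next message constrains only the sender's tape, so `D` is a conditional probability over
  -- the opponent's tape alone. If `c = 0`, all the masses vanish.
  refine ⟨d / c, ⟨div_nonneg hd hc, div_le_one_of_le₀ hdc hc⟩, fun m => ?_⟩
  have e1 : P.mass μ (t ++ [m]) = (μ p).real (P.consistent (t ++ [m]) p) * c := by
    rw [mass, cylinder, measureReal_party_pi μ p, P.consistent_concat_of_ne t m hne]
  have e2 : P.defenseMass μ p t m = (μ p).real (P.consistent (t ++ [m]) p) * d := by
    have : P.cylinder (t ++ [m]) ∩ {ω | P.defense p.other (ω p.other) t = true} =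
        univ.pi fun q => P.consistent (t ++ [m]) q ∩
          {r | q = p.other → P.defense q r t = true} := by
      ext ω
      simp only [cylinder, mem_inter_iff, mem_univ_pi, mem_ofPred_eq, forall_and]
      refine and_congr_right fun _ => ⟨?_, fun h => h _ rfl⟩
      rintro h q rfl
      exact h
    rw [defenseMass, this, measureReal_party_pi μ p, P.consistent_concat_of_ne t m hne]
    simp [(Party.other_ne p).symm, d]
  rw [e1, e2]
  rcases hc.eq_or_lt with h | h
  · obtain h' : d = 0 := by linarith
    simp [← h, h']
  · field_simp

lemma attackGain_le {σ : ℝ} (hσ : |σ| ≤ 1) (p : Party) (t : List M) (m : M) :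
    σ * (P.defenseMass μ p t m - P.headsMass μ n (t ++ [m])) ≤ P.mass μ (t ++ [m]) := by
  refine (le_abs_self _).trans ?_
  rw [abs_mul]
  have h := P.defenseMass_nonneg μ p t m
  have h1 := P.defenseMass_le μ p t m
  have h2 := P.headsMass_nonneg μ n (t ++ [m])
  have h3 := P.headsMass_le μ n (t ++ [m])
  refine (mul_le_of_le_one_left (abs_nonneg _) hσ).trans ?_
  rw [abs_le]
  constructor <;> linarith

variable {P μ n} in
lemma IsCoinTossing.mem_Icc {x : ℝ} (hP : P.IsCoinTossing μ n x) : x ∈ Icc (0 : ℝ) 1 := by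
  rw [← hP.bias .alice]
  exact ⟨measureReal_nonneg, measureReal_le_one⟩

variable [MeasurableSingletonClass M]

lemma measurableSet_consistent (t : List M) (p : Party) :
    MeasurableSet (P.consistent t p) := by
  induction t using List.reverseRecOn with
  | nil => rw [consistent_nil]; exact .univ
  | append_singleton t m ih =>
    rw [consistent_concat]
    refine ih.inter ?_
    by_cases hp : sender t.length = p
    · simp only [hp, forall_const]
      exact P.measurable_next p t (measurableSet_singleton m)
    · simp [hp]

lemma measurableSet_cylinder (t : List M) :
    MeasurableSet (P.cylinder t) :=
  .univ_pi (P.measurableSet_consistent t)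

variable {P μ n}

/-- A complete transcript determines the outcome. -/
lemma IsCoinTossing.headsMass_complete {x : ℝ} (hP : P.IsCoinTossing μ n x) {t : List M}
    (ht : t.length = n) : P.headsMass μ n t = 0 ∨ P.headsMass μ n t = P.mass μ t := by
  subst ht
  set Q : ∀ p, Bool → Set (Ω p) := fun p b => P.consistent t p ∩ {r | P.output p r t = b}
  have meas : ∀ p b, MeasurableSet (Q p b) := fun p b =>
    (P.measurableSet_consistent t p).inter (P.measurable_output p t (measurableSet_singleton b))
  have heads : ∀ p, P.headsMass μ t.length t =
      (μ p).real (Q p true) * (μ p.other).real (P.consistent t p.other) := by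
    intro p
    rw [hP.headsMass_eq p]
    have : P.cylinder t ∩ {ω | P.honestOutput t.length p ω = true} =
        univ.pi fun q => P.consistent t q ∩ {r | q = p → P.output q r t = true} := by
      ext ω
      have key : ω ∈ P.cylinder t ∩ {ω | P.honestOutput t.length p ω = true} ↔
          ω ∈ P.cylinder t ∧ P.output p (ω p) t = true :=
        and_congr_right fun h => by rw [mem_ofPred_eq, P.honestOutput_of_mem_cylinder h]
      rw [key]
      simp only [cylinder, mem_inter_iff, mem_univ_pi, mem_ofPred_eq, forall_and]
      refine and_congr_right fun _ => ⟨?_, fun h => h _ rfl⟩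
      rintro h q rfl
      exact h
    rw [this, measureReal_party_pi μ p]
    simp [Party.other_ne, Q]
  -- The rectangle "Alice heads, Bob tails" lies in the null event of disagreement, so one of its
  -- sides is null.
  have zero : (μ .alice).real (Q .alice true) * (μ .bob).real (Q .bob false) = 0 := by
    have h : (Measure.pi μ).real (univ.pi fun q => Q q (decide (q = .alice))) =
        (μ .alice).real (Q .alice true) * (μ .bob).real (Q .bob false) :=
      measureReal_party_pi μ .alice _
    rw [← h, measureReal_def, measure_mono_null _ (ae_iff.1 hP.agree), ENNReal.toReal_zero]
    intro ω hω
    simp only [Q, mem_univ_pi, mem_inter_iff, mem_ofPred_eq, forall_and] at hω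
    have hc : ω ∈ P.cylinder t := by simpa [cylinder] using hω.1
    simp [P.honestOutput_of_mem_cylinder hc, hω.2]
  rcases mul_eq_zero.1 zero with h | h
  · left
    rw [heads .alice, h, zero_mul]
  · right
    have split : (μ .bob).real (P.consistent t .bob) = (μ .bob).real (Q .bob true) := by
      have := measureReal_union (μ := μ .bob) (s₁ := Q .bob true) (s₂ := Q .bob false)
        (by
          refine Set.disjoint_left.2 fun r h1 h2 => ?_
          have e1 : P.output .bob r t = true := h1.2
          have e2 : P.output .bob r t = false := h2.2
          simp [e1] at e2) (meas _ _)
      rw [h, add_zero] at this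
      rw [← this]
      congr 1
      ext r
      simp only [Q, mem_union, mem_inter_iff, mem_ofPred_eq]
      cases P.output .bob r t <;> simp
    rw [heads .bob, mass, cylinder, measureReal_party_pi μ .bob, split]

/-! ### Attacks -/

variable (P μ n)

variable [Countable M]

/-- Only the cylinders have to be measurable: restricting `ν` to an arbitrary `S` is still countably
additive on them. This covers the events defined by attacked outputs. -/
lemma hasSum_cylinder (ν : Measure (∀ p, Ω p)) [IsFiniteMeasure ν]
    (t : List M) (S : Set (∀ p, Ω p)) :
    HasSum (fun m => ν.real (P.cylinder (t ++ [m]) ∩ S)) (ν.real (P.cylinder t ∩ S)) := by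
  have hd : Pairwise (Function.onFun Disjoint fun m => P.cylinder (t ++ [m])) := by
    intro a b hab
    refine Set.disjoint_left.2 fun ω ha hb => hab ?_
    rw [← (P.mem_cylinder_concat.1 ha).2, (P.mem_cylinder_concat.1 hb).2]
  have hU : P.cylinder t = ⋃ m, P.cylinder (t ++ [m]) := by
    ext ω
    simp [mem_cylinder_concat]
  have h := measure_iUnion (μ := ν.restrict S) hd fun m => P.measurableSet_cylinder (t ++ [m])
  rw [← hU] at h
  have hs := ENNReal.hasSum_toReal (f := fun m => (ν.restrict S) (P.cylinder (t ++ [m])))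
    (by rw [← h]; exact measure_ne_top _ _)
  rw [← ENNReal.tsum_toReal_eq (fun m => measure_ne_top _ _), ← h] at hs
  simpa only [measureReal_def, Measure.restrict_apply (P.measurableSet_cylinder _)] using hs

lemma hasSum_mass (t : List M) : HasSum (fun m => P.mass μ (t ++ [m])) (P.mass μ t) := by
  simpa [mass] using P.hasSum_cylinder (Measure.pi μ) t univ

lemma hasSum_headsMass (t : List M) :
    HasSum (fun m => P.headsMass μ n (t ++ [m])) (P.headsMass μ n t) :=
  P.hasSum_cylinder (Measure.pi μ) t _

lemma gain_mem_Icc {σ : ℝ} (hσ : |σ| ≤ 1) (p : Party) (k : ℕ) (t : List M) :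
    P.gain μ n p σ k t ∈ Icc 0 (P.mass μ t) := by
  induction k generalizing t with
  | zero => exact ⟨le_rfl, P.mass_nonneg μ t⟩
  | succ k ih =>
    rw [gain, ← (P.hasSum_mass μ t).tsum_eq]
    have hs := (P.hasSum_mass μ t).summable
    split_ifs with h
    · have h0 : ∀ m, 0 ≤ max (P.gain μ n p σ k (t ++ [m]))
          (σ * (P.defenseMass μ p t m - P.headsMass μ n (t ++ [m]))) :=
        fun m => le_max_of_le_left (ih _).1
      have h1 : ∀ m, max (P.gain μ n p σ k (t ++ [m]))
          (σ * (P.defenseMass μ p t m - P.headsMass μ n (t ++ [m]))) ≤ P.mass μ (t ++ [m]) :=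
        fun m => max_le (ih _).2 (P.attackGain_le μ n hσ p t m)
      exact ⟨tsum_nonneg h0, (hs.of_nonneg_of_le h0 h1).tsum_le_tsum h1 hs⟩
    · exact ⟨tsum_nonneg fun m => (ih _).1,
        (hs.of_nonneg_of_le (fun m => (ih _).1) fun m => (ih _).2).tsum_le_tsum
          (fun m => (ih _).2) hs⟩

lemma hasSum_gain_of_sender_eq {σ : ℝ} (hσ : |σ| ≤ 1) {p : Party} {t : List M}
    (hp : sender t.length = p) (k : ℕ) :
    HasSum (fun m => max (P.gain μ n p σ k (t ++ [m]))
      (σ * (P.defenseMass μ p t m - P.headsMass μ n (t ++ [m])))) (P.gain μ n p σ (k + 1) t) := by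
  rw [gain, if_pos hp]
  exact ((P.hasSum_mass μ t).summable.of_nonneg_of_le
    (fun m => le_max_of_le_left (P.gain_mem_Icc μ n hσ p k _).1)
    (fun m => max_le (P.gain_mem_Icc μ n hσ p k _).2 (P.attackGain_le μ n hσ p t m))).hasSum

lemma hasSum_gain_of_sender_ne {σ : ℝ} (hσ : |σ| ≤ 1) {p : Party} {t : List M}
    (hp : sender t.length ≠ p) (k : ℕ) :
    HasSum (fun m => P.gain μ n p σ k (t ++ [m])) (P.gain μ n p σ (k + 1) t) := by
  rw [gain, if_neg hp]
  exact ((P.hasSum_mass μ t).summable.of_nonneg_of_le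
    (fun m => (P.gain_mem_Icc μ n hσ p k _).1)
    (fun m => (P.gain_mem_Icc μ n hσ p k _).2)).hasSum

/-- The adversary who aborts as soon as this is at least as good as any later attack. -/
noncomputable def greedyAdversary (p : Party) (σ : ℝ) : FailStopAdversary Ω M p where
  abort r t :=
    open Classical in
    decide (P.gain μ n p σ (n - (t.length + 1)) (t ++ [P.next p r t]) ≤
      σ * (P.defenseMass μ p t (P.next p r t) - P.headsMass μ n (t ++ [P.next p r t])))
  measurable_abort t := by
    classical
    exact (measurable_of_countable fun m : M =>
      decide (P.gain μ n p σ (n - (t.length + 1)) (t ++ [m]) ≤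
        σ * (P.defenseMass μ p t m - P.headsMass μ n (t ++ [m])))).comp (P.measurable_next p t)

variable {P μ n}

/-- Dynamic programming: both sides satisfy the same recursion over the next message, since the
greedy adversary picks the larger term of each maximum. With no rounds left, agreement of the
outputs makes the gain zero. -/
lemma IsCoinTossing.gain_eq {x : ℝ} (hP : P.IsCoinTossing μ n x) {σ : ℝ} (hσ : |σ| ≤ 1)
    (p : Party) (k : ℕ) (t : List M) (ht : t.length + k = n) :
    P.gain μ n p σ k t = σ * ((Measure.pi μ).real (P.cylinder t ∩
      {ω | P.attackedOutputFrom (P.greedyAdversary μ n p σ) ω k t = true})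
        - P.headsMass μ n t) := by
  induction k generalizing t with
  | zero =>
    have : P.cylinder t ∩
        {ω | P.attackedOutputFrom (P.greedyAdversary μ n p σ) ω 0 t = true} =
        P.cylinder t ∩ {ω | P.honestOutput n p.other ω = true} := by
      ext ω
      refine and_congr_right fun h => ?_
      simp only [mem_ofPred_eq, attackedOutputFrom, ← ht, add_zero]
      rw [P.honestOutput_of_mem_cylinder h]
    rw [this, ← hP.headsMass_eq, sub_self, mul_zero, gain]
  | succ k ih =>
    have hk : n - (t.length + 1) = k := by omega
    have htot := ((P.hasSum_cylinder (Measure.pi μ) t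
      {ω | P.attackedOutputFrom (P.greedyAdversary μ n p σ) ω (k + 1) t = true}).sub
        (P.hasSum_headsMass μ n t)).mul_left σ
    by_cases hp : sender t.length = p
    · refine (P.hasSum_gain_of_sender_eq μ n hσ hp k).unique (htot.congr_fun fun m => ?_)
      by_cases hab : P.gain μ n p σ k (t ++ [m]) ≤
        σ * (P.defenseMass μ p t m - P.headsMass μ n (t ++ [m]))
      · rw [max_eq_right hab, defenseMass]
        congr 3
        ext ω
        refine and_congr_right fun h => ?_
        have hm := (P.mem_cylinder_concat.1 h).2
        rw [hp] at hm
        simp [attackedOutputFrom, hp, greedyAdversary, hm, hk, hab]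
      · rw [max_eq_left (le_of_not_ge hab), ih _ (by simp; omega)]
        congr 3
        ext ω
        refine and_congr_right fun h => ?_
        have hm := (P.mem_cylinder_concat.1 h).2
        rw [hp] at hm
        have : (P.greedyAdversary μ n p σ).abort (ω p) t = false := by
          simpa [greedyAdversary, hm, hk] using hab
        simp [attackedOutputFrom, this, P.extend_of_mem_cylinder h]
    · refine (P.hasSum_gain_of_sender_ne μ n hσ hp k).unique (htot.congr_fun fun m => ?_)
      rw [ih _ (by simp; omega)]
      congr 3
      ext ω
      refine and_congr_right fun h => ?_
      simp [attackedOutputFrom, hp, P.extend_of_mem_cylinder h]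

/-! ### The induction over the rounds -/

variable (P μ n)

/-- One round: any affine function which is below the larger of the later gain and the gap between
defense and outcome after each message bounds the gain before the message. -/
lemma le_totalGain_succ (k : ℕ) (t : List M) :
    ∃ D ∈ Icc (0 : ℝ) 1, ∀ α β : ℝ,
      (∀ m, α * P.mass μ (t ++ [m]) + β * P.headsMass μ n (t ++ [m]) ≤
        max (P.totalGain μ n k (t ++ [m]))
          |D * P.mass μ (t ++ [m]) - P.headsMass μ n (t ++ [m])|) →
      α * P.mass μ t + β * P.headsMass μ n t ≤ P.totalGain μ n (k + 1) t := by
  obtain ⟨p, hp⟩ : ∃ p, sender t.length = p := ⟨_, rfl⟩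
  have hne : sender t.length ≠ p.other := hp ▸ (Party.other_ne _).symm
  obtain ⟨D, hD, hd⟩ := P.exists_defenseMass_eq μ hp
  refine ⟨D, hD, fun α β h => ?_⟩
  have h1 : |(1 : ℝ)| ≤ 1 := by simp
  have h2 : |(-1 : ℝ)| ≤ 1 := by simp
  rw [P.totalGain_eq μ n p]
  refine hasSum_le (fun m => (h m).trans ?_)
    (((P.hasSum_mass μ t).mul_left α).add ((P.hasSum_headsMass μ n t).mul_left β))
    (((P.hasSum_gain_of_sender_eq μ n h1 hp k).add (P.hasSum_gain_of_sender_eq μ n h2 hp k)).add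
      ((P.hasSum_gain_of_sender_ne μ n h1 hne k).add (P.hasSum_gain_of_sender_ne μ n h2 hne k)))
  rw [P.totalGain_eq μ n p, hd]
  have g1 := (P.gain_mem_Icc μ n h1 p k (t ++ [m])).1
  have g2 := (P.gain_mem_Icc μ n h2 p k (t ++ [m])).1
  have g3 := (P.gain_mem_Icc μ n h1 p.other k (t ++ [m])).1
  have g4 := (P.gain_mem_Icc μ n h2 p.other k (t ++ [m])).1
  set e := D * P.mass μ (t ++ [m]) - P.headsMass μ n (t ++ [m])
  -- The sender's two maxima dominate both her later gains and `±e`. All gains being nonnegative,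
  -- the sum of four is at least the later total and at least `|e|`.
  have m1 := le_max_left (P.gain μ n p 1 k (t ++ [m])) (1 * e)
  have m2 := le_max_right (P.gain μ n p 1 k (t ++ [m])) (1 * e)
  have m3 := le_max_left (P.gain μ n p (-1) k (t ++ [m])) (-1 * e)
  have m4 := le_max_right (P.gain μ n p (-1) k (t ++ [m])) (-1 * e)
  refine max_le (by linarith) (abs_le'.2 ⟨by linarith, by linarith⟩)

variable {P μ n}

lemma IsCoinTossing.le_totalGain {x : ℝ} (hP : P.IsCoinTossing μ n x) (k : ℕ) (t : List M)
    (ht : t.length + (k + 1) = n) :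
    P.mass μ t * (1 / 3 * unfairnessCurve (k + 1) (P.headsMass μ n t / P.mass μ t)) ≤
      P.totalGain μ n (k + 1) t := by
  -- On null transcripts the quotient is `0 / 0 = 0`, which is harmless as it is always weighted by
  -- the mass.
  have frac : ∀ s, P.headsMass μ n s / P.mass μ s ∈ Icc (0 : ℝ) 1 := fun s =>
    ⟨div_nonneg (P.headsMass_nonneg μ n s) (P.mass_nonneg μ s),
      div_le_one_of_le₀ (P.headsMass_le μ n s) (P.mass_nonneg μ s)⟩
  have cancel : ∀ s, P.mass μ s * (P.headsMass μ n s / P.mass μ s) = P.headsMass μ n s := by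
    intro s
    rcases (P.mass_nonneg μ s).eq_or_lt with h | h
    · have := P.headsMass_nonneg μ n s
      have := P.headsMass_le μ n s
      rw [← h, zero_mul]; linarith
    · field_simp
  induction k generalizing t with
  | zero =>
    obtain ⟨D, hD, hstep⟩ := P.le_totalGain_succ μ n 0 t
    have w0 := P.mass_nonneg μ t
    -- After the last message the probability of heads is 0 or 1, and `D + (1 - 2 * D) * y`
    -- interpolates `|D - y|` at these two points.
    refine le_trans ?_ (hstep D (1 - 2 * D) fun m => le_max_of_le_right ?_)
    · have c := cancel t
      obtain ⟨y0, y1⟩ := frac t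
      set y := P.headsMass μ n t / P.mass μ t
      have : 1 / 3 * (y * (1 - y)) ≤ D + (1 - 2 * D) * y := by
        nlinarith [mul_nonneg hD.1 (sub_nonneg.2 y1), mul_nonneg (sub_nonneg.2 hD.2) y0,
          mul_nonneg y0 (sub_nonneg.2 y1), mul_nonneg (mul_nonneg hD.1 (sub_nonneg.2 y1)) y0,
          mul_nonneg (mul_nonneg (sub_nonneg.2 hD.2) y0) (sub_nonneg.2 y1),
          mul_nonneg (mul_nonneg hD.1 (sub_nonneg.2 y1)) (sub_nonneg.2 y1),
          mul_nonneg (mul_nonneg (sub_nonneg.2 hD.2) y0) y0]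
      have := mul_le_mul_of_nonneg_left this w0
      rw [zero_add, unfairnessCurve_one]
      linear_combination this + (1 - 2 * D) * c
    · rcases hP.headsMass_complete (t := t ++ [m]) (by simpa using ht) with h | h
      · rw [h, mul_zero, add_zero, sub_zero]
        exact le_abs_self _
      · rw [h]
        refine le_trans (by linarith) (neg_le_abs _)
  | succ k ih =>
    obtain ⟨D, hD, hstep⟩ := P.le_totalGain_succ μ n (k + 1) t
    have w0 := P.mass_nonneg μ t
    obtain ⟨α, β, hx, hαβ⟩ :=
      (admissibleCurve_unfairnessCurve k).exists_affine_minorant hD (frac t)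
    refine le_trans ?_ (hstep α β fun m => ?_)
    · rw [unfairnessCurve_succ_succ]
      refine (mul_le_mul_of_nonneg_left hx w0).trans_eq ?_
      linear_combination β * cancel t
    · have wm := P.mass_nonneg μ (t ++ [m])
      have h := mul_le_mul_of_nonneg_left (hαβ _ (frac (t ++ [m]))) wm
      have c := cancel (t ++ [m])
      have e : P.mass μ (t ++ [m]) * |D - P.headsMass μ n (t ++ [m]) / P.mass μ (t ++ [m])| =
          |D * P.mass μ (t ++ [m]) - P.headsMass μ n (t ++ [m])| := by
        conv_lhs => rw [← abs_of_nonneg wm, ← abs_mul, abs_of_nonneg wm, mul_sub, c, mul_comm]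
      rw [mul_max_of_nonneg _ _ wm, e] at h
      refine le_trans (le_of_eq ?_) (h.trans (max_le_max_right _ (ih _ ?_)))
      · linear_combination -β * c
      · rw [List.length_append, List.length_singleton]; omega

lemma IsCoinTossing.exists_adversary {x : ℝ} (hP : P.IsCoinTossing μ (n + 1) x) :
    ∃ (p : Party) (A : FailStopAdversary Ω M p),
      1 / 12 * unfairnessCurve (n + 1) x ≤
        |(Measure.pi μ).real {ω | P.attackedOutput (n + 1) A ω = true} - x| := by
  have hm : P.mass μ [] = 1 := by simp [mass, cylinder_nil]
  have hh : P.headsMass μ (n + 1) [] = x := by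
    rw [← hP.bias .alice, headsMass, cylinder_nil, univ_inter]
  have key := hP.le_totalGain n [] (by simp)
  rw [hm, hh, div_one, one_mul, P.totalGain_eq μ (n + 1) .alice] at key
  by_contra! hcon
  have bound : ∀ (p : Party) (σ : ℝ), |σ| ≤ 1 → P.gain μ (n + 1) p σ (n + 1) [] <
      1 / 12 * unfairnessCurve (n + 1) x := by
    intro p σ hσ
    refine lt_of_le_of_lt ?_ (hcon p (P.greedyAdversary μ (n + 1) p σ))
    rw [hP.gain_eq hσ p (n + 1) [] (by simp), hh, cylinder_nil, univ_inter]
    refine (le_abs_self _).trans ?_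
    rw [abs_mul]
    exact mul_le_of_le_one_left (abs_nonneg _) hσ
  have h1 : |(1 : ℝ)| ≤ 1 := by simp
  have h2 : |(-1 : ℝ)| ≤ 1 := by simp
  linarith [bound .alice 1 h1, bound .alice (-1) h2, bound Party.alice.other 1 h1,
    bound Party.alice.other (-1) h2]

end TwoPartyProtocol

theorem mainTheorem3 {Ω : Party → Type u} {M : Type v}
    [∀ p, MeasurableSpace (Ω p)] [Countable M] [MeasurableSpace M] [MeasurableSingletonClass M]
    (μ : ∀ p, Measure (Ω p)) [∀ p, IsProbabilityMeasure (μ p)]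
    (n : ℕ) (hn : 1 ≤ n) (X₀ : ℝ)
    (P : TwoPartyProtocol Ω M) (hP : P.IsCoinTossing μ n X₀) :
    -- the transform is applied only to curves for which its two equations are uniquely solvable
    (∀ k : ℕ, 1 ≤ k → ∀ x ∈ Icc (0 : ℝ) 1,
      (∃! X : ℝ, X ∈ Icc (0 : ℝ) 1 ∧ X + unfairnessCurve k X = x) ∧
      (∃! X : ℝ, X ∈ Icc (0 : ℝ) 1 ∧ X - unfairnessCurve k X = x)) ∧
    (∃ (p : Party) (A : FailStopAdversary Ω M p),
      1 / 12 * unfairnessCurve n X₀ ≤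
        |(Measure.pi μ).real {ω | P.attackedOutput n A ω = true} - X₀|) ∧
    1 / 12 * (Real.sqrt (2 / ((n : ℝ) + 1)) * X₀ * (1 - X₀)) ≤ 1 / 12 * unfairnessCurve n X₀ := by
  obtain ⟨n, rfl⟩ := Nat.exists_eq_add_of_le' hn
  refine ⟨fun k hk x hx => ?_, hP.exists_adversary, ?_⟩
  · obtain ⟨k, rfl⟩ := Nat.exists_eq_add_of_le' hk
    have hf := admissibleCurve_unfairnessCurve k
    exact ⟨hf.existsUnique_add hx, hf.existsUnique_sub hx⟩
  · have := le_unfairnessCurve n hP.mem_Icc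
    rw [mul_assoc (Real.sqrt _)]
    linarith
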